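/- Let $s,t\ge 2$ be integers, let $n=s+t-1$, and let $K_n^{s,t}$ be the graph on $n$ vertices obtained from disjoint complete graphs $K_s$ and $K_t$ by identifying one vertex of $K_s$ with one vertex of $K_t$. For a finite connected simple graph $G$, the distance matrix $D(G)$ has as its $(u,v)$ entry the length of a shortest path from $u$ to $v$, and the distance spectrum of $G$ is the multiset of eigenvalues of $D(G)$. Then $K_n^{s,t}$ is determined by its distance spectrum: it is connected, and every finite connected simple graph $G$ with the same distance spectrum as $K_n^{s,t}$ is isomorphic to $K_n^{s,t}$. -/

import Mathlib

universe u v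

namespace DSpectrum

/-- The distance matrix `D(G) = (d(x, y))` of a graph, with real entries. It is used for connected
graphs only, where `SimpleGraph.dist` is the usual length of a shortest path. -/
noncomputable def distMatrix {V : Type u} (G : SimpleGraph V) : Matrix V V ℝ :=
  Matrix.of fun x y => (G.dist x y : ℝ)

/-- The distance spectrum: the eigenvalues of `D(G)`, with multiplicity, as the multiset of roots of
`det (X I - D(G))`. As `D(G)` is real symmetric, all its `|V|` eigenvalues are real, so that
this multiset has `|V|` elements. -/
noncomputable def distSpectrum {V : Type u} [Fintype V] [DecidableEq V] (G : SimpleGraph V) :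
    Multiset ℝ :=
  (distMatrix G).charpoly.roots

/-- Two graphs are `D`-cospectral if they have the same distance spectrum. -/
def DCospectral {V : Type u} {W : Type v} [Fintype V] [DecidableEq V] [Fintype W] [DecidableEq W]
    (G : SimpleGraph V) (H : SimpleGraph W) : Prop :=
  distSpectrum G = distSpectrum H

/-- A connected finite graph `G` is determined by its distance spectrum if every connected finite
graph that is `D`-cospectral to `G` is isomorphic to `G`. -/
def DeterminedByDSpectrum {V : Type u} [Fintype V] [DecidableEq V] (G : SimpleGraph V) : Prop :=
  G.Connected ∧
    ∀ (W : Type v) [Fintype W] [DecidableEq W] (H : SimpleGraph W),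
      H.Connected → DCospectral H G → Nonempty (H ≃g G)

/-- The graph `K_n^{s,t}` with `n = s + t - 1` (for `s, t ≥ 1`), obtained by identifying a vertex of
`K_s` with a vertex of `K_t`: a clique on the `s` vertices `0, …, s - 1` and a clique on the `t`
vertices `s - 1, …, s + t - 2`, which have exactly the vertex `s - 1` in common, and no other
edges. -/
def gluedCliques (s t : ℕ) : SimpleGraph (Fin (s + t - 1)) where
  Adj i j := i ≠ j ∧ ((i.val < s ∧ j.val < s) ∨ (s ≤ i.val + 1 ∧ s ≤ j.val + 1))
  symm := ⟨fun _ _ h => ⟨h.1.symm, h.2.imp And.symm And.symm⟩⟩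
  loopless := ⟨fun _ h => h.1 rfl⟩

end DSpectrum

/-! Put `M = D + 1`. In diameter at most two, `M = J + N` with `J` the all-ones matrix and `N` the
adjacency matrix of the complement. For two cliques glued at a vertex, the form of `M` is a square
on a hyperplane, so at most one eigenvalue of `D` is below `-1` (`IsGluing.countP_le_one`).

A cospectral connected `H` inherits this bound, so its form has no two orthogonal negative vectors.
This excludes distances above two, independent triples and induced pentagons. The traces of `M ^ 2`
and `M ^ 3` then give the number of nonadjacent pairs and their total number of common neighbours.
These agree, as they do in the gluing, so each nonadjacent pair has exactly one common neighbour
(`existsUnique_common_neighbor`).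

These facts force `H` to be two cliques sharing a vertex (`exists_isGluing`). The clique sizes
follow from the numbers of vertices and of nonadjacent pairs. -/

namespace DSpectrum

open Matrix

/-! ### Negative directions of `A + 1` and eigenvalues of `A` below `-1`. -/

section Spectral

variable {n : Type*} [Fintype n] [DecidableEq n]

/-- Orthogonal diagonalization of a real symmetric matrix. -/
theorem exists_orthogonal_diagonalization {A : Matrix n n ℝ} (hA : A.IsHermitian) :
    ∃ (P : Matrix n n ℝ) (l : n → ℝ), Pᵀ * P = 1 ∧ P * Pᵀ = 1 ∧ A = P * diagonal l * Pᵀ ∧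
      A.charpoly.roots = Finset.univ.val.map l := by
  refine ⟨hA.eigenvectorUnitary, hA.eigenvalues, ?_, ?_, ?_, ?_⟩
  · have := Unitary.coe_star_mul_self hA.eigenvectorUnitary
    rwa [star_eq_conjTranspose, conjTranspose_eq_transpose_of_trivial] at this
  · have := Unitary.coe_mul_star_self hA.eigenvectorUnitary
    rwa [Unitary.coe_star, star_eq_conjTranspose, conjTranspose_eq_transpose_of_trivial] at this
  · have := hA.spectral_theorem
    rw [Unitary.conjStarAlgAut_apply, star_eq_conjTranspose,
      conjTranspose_eq_transpose_of_trivial] at this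
    exact this
  · exact hA.roots_charpoly_eq_eigenvalues

theorem add_one_eq_conj {A P : Matrix n n ℝ} {l : n → ℝ} (hP : P * Pᵀ = 1)
    (hA : A = P * diagonal l * Pᵀ) : A + 1 = P * diagonal (fun i => l i + 1) * Pᵀ := by
  have : diagonal (fun i => l i + 1) = diagonal l + (1 : Matrix n n ℝ) := by
    rw [← diagonal_one, diagonal_add]
  rw [this, mul_add, add_mul, ← hA, mul_one, hP]

/-- The traces of the powers of `A + 1` are determined by the spectrum of `A`. -/
theorem trace_add_one_pow {A : Matrix n n ℝ} (hA : A.IsHermitian) (k : ℕ) :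
    ((A + 1) ^ k).trace = (A.charpoly.roots.map fun r => (r + 1) ^ k).sum := by
  obtain ⟨P, l, h1, h2, h3, h4⟩ := exists_orthogonal_diagonalization hA
  have hpow : (A + 1) ^ k = P * diagonal (fun i => (l i + 1) ^ k) * Pᵀ := by
    induction k with
    | zero => simp [h2]
    | succ k ih =>
      rw [pow_succ, ih, add_one_eq_conj h2 h3]
      calc _ = P * diagonal (fun i => (l i + 1) ^ k) * (Pᵀ * P) *
            diagonal (fun i => l i + 1) * Pᵀ := by simp only [mul_assoc]
        _ = _ := by
          rw [h1, mul_one, mul_assoc P, diagonal_mul_diagonal]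
          simp only [pow_succ]
  rw [hpow, trace_mul_comm, ← mul_assoc, h1, one_mul, trace_diagonal, h4, Multiset.map_map]
  rfl

theorem toBilin'_add_one_eq_sum {A P : Matrix n n ℝ} {l : n → ℝ} (hP : P * Pᵀ = 1)
    (hA : A = P * diagonal l * Pᵀ) (x y : n → ℝ) :
    toBilin' (A + 1) x y = ∑ i, (l i + 1) * (Pᵀ *ᵥ x) i * (Pᵀ *ᵥ y) i := by
  rw [add_one_eq_conj hP hA, toBilin'_apply', ← mulVec_mulVec, ← mulVec_mulVec, dotProduct_mulVec,
    ← mulVec_transpose, dotProduct]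
  refine Finset.sum_congr rfl fun i _ => ?_
  rw [mulVec_diagonal]
  ring

/-- If the form of `A + 1` is nonnegative on a hyperplane, then at most one eigenvalue of `A` is
less than `-1`. -/
theorem countP_roots_lt_neg_one_le_one {A : Matrix n n ℝ} (hA : A.IsHermitian)
    (f : (n → ℝ) →ₗ[ℝ] ℝ) (hf : ∀ x, f x = 0 → 0 ≤ toBilin' (A + 1) x x) :
    A.charpoly.roots.countP (· < -1) ≤ 1 := by
  obtain ⟨P, l, h1, h2, h3, h4⟩ := exists_orthogonal_diagonalization hA
  rw [h4, Multiset.countP_map, ← Finset.filter_val, Finset.card_val, Finset.card_le_one]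
  intro i hi j hj
  simp only [Finset.mem_filter, Finset.mem_univ, true_and] at hi hj
  by_contra hij
  have key : ∀ a b : ℝ, f (P *ᵥ (Pi.single i a + Pi.single j b)) = 0 →
      0 ≤ a ^ 2 * (l i + 1) + b ^ 2 * (l j + 1) := by
    intro a b hab
    have := hf _ hab
    rw [toBilin'_add_one_eq_sum h2 h3, mulVec_mulVec, h1, one_mulVec] at this
    have hsum : ∑ k, (l k + 1) * (Pi.single i a + Pi.single j b : n → ℝ) k *
        (Pi.single i a + Pi.single j b : n → ℝ) k =
        ∑ k, ((if k = i then a ^ 2 * (l i + 1) else 0) +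
          if k = j then b ^ 2 * (l j + 1) else 0) := by
      refine Finset.sum_congr rfl fun k _ => ?_
      by_cases hki : k = i
      · subst hki
        simp [hij]
        ring
      · by_cases hkj : k = j
        · subst hkj
          simp [hki]
          ring
        · simp [hki, hkj]
    rw [hsum, Finset.sum_add_distrib] at this
    simpa using this
  have hlin : ∀ a b : ℝ, f (P *ᵥ (Pi.single i a + Pi.single j b)) =
      a * f (P *ᵥ Pi.single i 1) + b * f (P *ᵥ Pi.single j 1) := by
    intro a b
    have ha : (Pi.single i a : n → ℝ) = a • Pi.single i 1 := by simp [← Pi.single_smul]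
    have hb : (Pi.single j b : n → ℝ) = b • Pi.single j 1 := by simp [← Pi.single_smul]
    rw [ha, hb, mulVec_add, mulVec_smul, mulVec_smul, map_add, map_smul, map_smul, smul_eq_mul,
      smul_eq_mul]
  -- The plane spanned by the two eigenvectors meets the kernel of `f` nontrivially, yet the form is
  -- negative definite there.
  by_cases hz : f (P *ᵥ Pi.single i 1) = 0
  · have := key 1 0 (by rw [hlin, hz]; ring)
    linarith
  · have := key (f (P *ᵥ Pi.single j 1)) (-f (P *ᵥ Pi.single i 1)) (by rw [hlin]; ring)
    have hpos : 0 < f (P *ᵥ Pi.single i 1) ^ 2 := by positivity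
    nlinarith [sq_nonneg (f (P *ᵥ Pi.single j 1))]

/-- If at most one eigenvalue of `A` is less than `-1`, then the form of `A + 1` has no two
orthogonal negative vectors. -/
theorem not_two_negative_of_countP_le_one {A : Matrix n n ℝ} (hA : A.IsHermitian)
    (hc : A.charpoly.roots.countP (· < -1) ≤ 1) (x y : n → ℝ)
    (hx : toBilin' (A + 1) x x < 0) (hy : toBilin' (A + 1) y y < 0)
    (hxy : toBilin' (A + 1) x y = 0) : False := by
  obtain ⟨P, l, h1, h2, h3, h4⟩ := exists_orthogonal_diagonalization hA
  rw [h4, Multiset.countP_map, ← Finset.filter_val, Finset.card_val, Finset.card_le_one] at hc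
  simp only [Finset.mem_filter, Finset.mem_univ, true_and] at hc
  rw [toBilin'_add_one_eq_sum h2 h3] at hx hy hxy
  set c := Pᵀ *ᵥ x
  set d := Pᵀ *ᵥ y
  obtain ⟨i, hi⟩ : ∃ i, l i < -1 := by
    by_contra! h
    refine absurd hx (not_lt.2 (Finset.sum_nonneg fun i _ => ?_))
    rw [mul_assoc]
    exact mul_nonneg (by linarith [h i]) (mul_self_nonneg _)
  have key : ∀ z : n → ℝ, z i = 0 → 0 ≤ ∑ k, (l k + 1) * z k * z k := by
    intro z hz
    refine Finset.sum_nonneg fun k _ => ?_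
    by_cases hk : l k < -1
    · rw [hc k hk i hi, hz]
      simp
    · rw [mul_assoc]
      exact mul_nonneg (by linarith) (mul_self_nonneg _)
  -- This combination kills the coordinate of the only negative eigenvalue. By orthogonality its
  -- form is a weighted sum of two negative values, negative unless `c i = 0`.
  have h := key (fun k => d i * c k - c i * d k) (by ring)
  have hexp : ∑ k, (l k + 1) * (d i * c k - c i * d k) * (d i * c k - c i * d k) =
      d i ^ 2 * ∑ k, (l k + 1) * c k * c k + c i ^ 2 * ∑ k, (l k + 1) * d k * d k -
        2 * d i * c i * ∑ k, (l k + 1) * c k * d k := by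
    simp only [Finset.mul_sum, ← Finset.sum_add_distrib, ← Finset.sum_sub_distrib]
    exact Finset.sum_congr rfl fun k _ => by ring
  rw [hexp, hxy] at h
  by_cases hci : c i = 0
  · exact absurd hx (not_lt.2 (key c hci))
  · have hpos : 0 < c i ^ 2 := by positivity
    nlinarith [sq_nonneg (d i)]

end Spectral

/-! ### Forbidden configurations. -/

section Forbidden

variable {V : Type*} {G : SimpleGraph V}

theorem isHermitian_distMatrix (G : SimpleGraph V) : (distMatrix G).IsHermitian := by
  ext x y
  simp [distMatrix, SimpleGraph.dist_comm]

theorem exists_adj_dist_eq (hG : G.Connected) {x y : V} {k : ℕ} (h : G.dist x y = k + 1) :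
    ∃ z, G.Adj x z ∧ G.dist z y = k := by
  obtain ⟨p, hp⟩ := hG.exists_walk_length_eq_dist x y
  cases p with
  | nil => simp at h
  | @cons _ z _ hxz q =>
    refine ⟨z, hxz, ?_⟩
    have h1 := SimpleGraph.dist_le q
    have h2 := hG.dist_triangle (u := x) (v := z) (w := y)
    rw [SimpleGraph.dist_eq_one_iff_adj.2 hxz] at h2
    rw [SimpleGraph.Walk.length_cons] at hp
    omega

theorem exists_dist_eq_three (hG : G.Connected) {x y : V} (h : 3 ≤ G.dist x y) :
    ∃ z, G.dist z y = 3 := by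
  obtain ⟨k, hk⟩ := Nat.exists_eq_add_of_le' h
  induction k generalizing x with
  | zero => exact ⟨x, by omega⟩
  | succ k ih =>
    obtain ⟨z, -, hz⟩ := exists_adj_dist_eq hG (k := k + 3) (x := x) (y := y) (by omega)
    exact ih (by omega) hz

theorem dist_eq_two (hG : G.Connected) (hd : ∀ x y, G.dist x y ≤ 2) {x y : V} (hxy : x ≠ y)
    (h : ¬ G.Adj x y) : G.dist x y = 2 :=
  le_antisymm (hd x y) (hG.one_lt_dist_of_ne_of_not_adj hxy h)

theorem distMatrix_add_one_self [DecidableEq V] (u : V) : (distMatrix G + 1) u u = 1 := by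
  simp [distMatrix]

theorem distMatrix_add_one_of_dist_eq [DecidableEq V] {u v : V} {k : ℕ} (huv : u ≠ v)
    (h : G.dist u v = k) : (distMatrix G + 1) u v = k := by
  simp [distMatrix, h, huv]

variable [Fintype V] [DecidableEq V]

/-- A graph whose distance matrix has at most one eigenvalue below `-1` has no isometric path on
four vertices, hence diameter at most two. -/
theorem dist_le_two_of_countP_le_one (hG : G.Connected)
    (hc : (distMatrix G).charpoly.roots.countP (· < -1) ≤ 1) (x y : V) : G.dist x y ≤ 2 := by
  by_contra! hlt
  obtain ⟨a, had⟩ := exists_dist_eq_three hG hlt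
  obtain ⟨b, hab, hbd⟩ := exists_adj_dist_eq hG had
  obtain ⟨c, hbc, hcd⟩ := exists_adj_dist_eq hG hbd
  rw [← SimpleGraph.dist_eq_one_iff_adj] at hab hbc
  have hac : G.dist a c = 2 := by
    have h1 := hG.dist_triangle (u := a) (v := b) (w := c)
    have h2 := hG.dist_triangle (u := a) (v := c) (w := y)
    omega
  have ne : ∀ {u v : V} {k : ℕ}, G.dist u v = k + 1 → u ≠ v := by
    rintro u v k h rfl
    simp at h
  have sy : ∀ {u v : V} {k : ℕ}, G.dist u v = k → G.dist v u = k := by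
    intro u v k h
    rwa [SimpleGraph.dist_comm]
  have B := fun {u v : V} {k : ℕ} (h : G.dist u v = k + 1) => distMatrix_add_one_of_dist_eq (ne h) h
  have D := distMatrix_add_one_self (G := G)
  have key := not_two_negative_of_countP_le_one (isHermitian_distMatrix G) hc
  generalize distMatrix G + 1 = M at B D key
  -- Reversing the path negates the first vector and fixes the second, hence orthogonality. Both
  -- have form `-4`.
  refine key
    (Pi.single a 1 - Pi.single y 1)
    ((2 : ℝ) • Pi.single a 1 - (3 : ℝ) • Pi.single b 1 - (3 : ℝ) • Pi.single c 1 +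
      (2 : ℝ) • Pi.single y 1) ?_ ?_ ?_ <;>
  · simp only [map_add, map_sub, map_smul, LinearMap.add_apply, LinearMap.sub_apply,
      LinearMap.smul_apply, smul_eq_mul, toBilin'_single, D, B hab, B hac, B had, B hbc, B hbd, B hcd, B (sy hab),
      B (sy hac), B (sy had), B (sy hbc), B (sy hbd), B (sy hcd)]
    norm_num

/-- A graph of diameter two whose distance matrix has at most one eigenvalue below `-1` has
independence number at most two. -/
theorem adj_of_countP_le_one (hG : G.Connected)
    (hc : (distMatrix G).charpoly.roots.countP (· < -1) ≤ 1) {a b c : V}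
    (hab : a ≠ b) (hac : a ≠ c) (hbc : b ≠ c) (nab : ¬ G.Adj a b) (nac : ¬ G.Adj a c) :
    G.Adj b c := by
  by_contra nbc
  have hd := dist_le_two_of_countP_le_one hG hc
  have B := fun {u v : V} (huv : u ≠ v) (h : ¬ G.Adj u v) =>
    distMatrix_add_one_of_dist_eq huv (dist_eq_two hG hd huv h)
  have sy : ∀ {u v : V}, ¬ G.Adj u v → ¬ G.Adj v u := fun h h' => h h'.symm
  have D := distMatrix_add_one_self (G := G)
  have key := not_two_negative_of_countP_le_one (isHermitian_distMatrix G) hc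
  generalize distMatrix G + 1 = M at B D key
  -- On the triple `M` is `2J - 1`, so on vectors of coordinate sum zero the form is minus the
  -- Euclidean one.
  refine key
    (Pi.single a 1 - Pi.single b 1)
    (Pi.single a 1 + Pi.single b 1 - (2 : ℝ) • Pi.single c 1) ?_ ?_ ?_ <;>
  · simp only [map_add, map_sub, map_smul, LinearMap.add_apply, LinearMap.sub_apply,
      LinearMap.smul_apply, toBilin'_single, D, B hab nab, B hac nac, B hbc nbc,
      B hab.symm (sy nab), B hac.symm (sy nac), B hbc.symm (sy nbc), smul_eq_mul]
    norm_num

/-- A graph whose distance matrix has at most one eigenvalue below `-1` has no induced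
pentagon. -/
theorem no_induced_pentagon_of_countP_le_one (hG : G.Connected)
    (hc : (distMatrix G).charpoly.roots.countP (· < -1) ≤ 1) {c u x y v : V}
    (hcu : G.Adj c u) (hux : G.Adj u x) (hxy : G.Adj x y) (hyv : G.Adj y v) (hvc : G.Adj v c)
    (hcx : ¬ G.Adj c x) (hcy : ¬ G.Adj c y) (huy : ¬ G.Adj u y) (huv : ¬ G.Adj u v)
    (hxv : ¬ G.Adj x v) : False := by
  have hd := dist_le_two_of_countP_le_one hG hc
  have E := fun {u v : V} (h : G.Adj u v) =>
    distMatrix_add_one_of_dist_eq h.ne (SimpleGraph.dist_eq_one_iff_adj.2 h)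
  have B := fun {u v : V} (huv : u ≠ v) (h : ¬ G.Adj u v) =>
    distMatrix_add_one_of_dist_eq huv (dist_eq_two hG hd huv h)
  have sy : ∀ {u v : V}, ¬ G.Adj u v → ¬ G.Adj v u := fun h h' => h h'.symm
  have ncx : c ≠ x := by rintro rfl; exact hcy hxy
  have ncy : c ≠ y := by rintro rfl; exact hcx hxy.symm
  have nuy : u ≠ y := by rintro rfl; exact huv hyv
  have nuv : u ≠ v := by rintro rfl; exact hxv hux.symm
  have nxv : x ≠ v := by rintro rfl; exact huv hux
  have D := distMatrix_add_one_self (G := G)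
  have key := not_two_negative_of_countP_le_one (isHermitian_distMatrix G) hc
  generalize distMatrix G + 1 = M at B E D key
  -- The reflection of the pentagon fixing `c` negates the first vector and fixes the second. Both
  -- have coordinate sum zero, so only nonadjacent pairs contribute: the forms are `-6` and `-10`.
  refine key
    (Pi.single u 1 + Pi.single x 1 - Pi.single y 1 - Pi.single v 1)
    (Pi.single u 1 + Pi.single x 1 + Pi.single y 1 + Pi.single v 1 - (4 : ℝ) • Pi.single c 1)
    ?_ ?_ ?_ <;>
  · simp only [map_add, map_sub, map_smul, LinearMap.add_apply, LinearMap.sub_apply,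
      LinearMap.smul_apply, toBilin'_single, D, E hcu, E hux, E hxy, E hyv, E hvc,
      E hcu.symm, E hux.symm, E hxy.symm, E hyv.symm, E hvc.symm, B ncx hcx, B ncy hcy, B nuy huy,
      B nuv huv, B nxv hxv, B ncx.symm (sy hcx), B ncy.symm (sy hcy), B nuy.symm (sy huy),
      B nuv.symm (sy huv), B nxv.symm (sy hxv), smul_eq_mul]
    norm_num

end Forbidden

/-! ### Traces of `M ^ 2` and `M ^ 3` as counts of nonadjacent pairs. -/

section Counting

variable {V : Type*} {G : SimpleGraph V}

open Classical in
/-- The indicator of pairs of distinct nonadjacent vertices. -/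
noncomputable def nonAdj (G : SimpleGraph V) (x y : V) : ℝ :=
  if x ≠ y ∧ ¬ G.Adj x y then 1 else 0

theorem nonAdj_of_adj {x y : V} (h : G.Adj x y) : nonAdj G x y = 0 := by simp [nonAdj, h]

theorem nonAdj_self (x : V) : nonAdj G x x = 0 := by simp [nonAdj]

theorem nonAdj_of_not_adj {x y : V} (hxy : x ≠ y) (h : ¬ G.Adj x y) : nonAdj G x y = 1 := by
  simp [nonAdj, h, hxy]

open Classical in
theorem nonAdj_comm (x y : V) : nonAdj G x y = nonAdj G y x := by
  exact if_congr (by rw [ne_comm, G.adj_comm]) rfl rfl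

theorem nonAdj_eq_zero_or_one (x y : V) : nonAdj G x y = 0 ∨ nonAdj G x y = 1 := by
  unfold nonAdj
  split_ifs <;> simp

theorem nonAdj_sq (x y : V) : nonAdj G x y * nonAdj G x y = nonAdj G x y := by
  rcases nonAdj_eq_zero_or_one (G := G) x y with h | h <;> simp [h]

theorem distMatrix_add_one_apply [DecidableEq V] (hG : G.Connected) (hd : ∀ x y, G.dist x y ≤ 2)
    (x y : V) : (distMatrix G + 1) x y = 1 + nonAdj G x y := by
  by_cases hxy : x = y
  · subst hxy
    simp [distMatrix, nonAdj_self]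
  · by_cases h : G.Adj x y
    · simp [distMatrix, nonAdj_of_adj h, hxy, SimpleGraph.dist_eq_one_iff_adj.2 h]
    · simp [distMatrix, nonAdj_of_not_adj hxy h, hxy, dist_eq_two hG hd hxy h]
      norm_num

variable [Fintype V]

/-- The sum over ordered pairs of nonadjacent vertices of the number of common neighbours. -/
noncomputable def commonNeighborSum (G : SimpleGraph V) : ℝ :=
  ∑ x, ∑ y, nonAdj G x y * ∑ z, (1 - nonAdj G x z) * (1 - nonAdj G y z)

/-- The number of ordered pairs of nonadjacent vertices. -/
noncomputable def nonAdjSum (G : SimpleGraph V) : ℝ := ∑ x, ∑ y, nonAdj G x y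

theorem trace_sq_eq [DecidableEq V] (hG : G.Connected) (hd : ∀ x y, G.dist x y ≤ 2) :
    ((distMatrix G + 1) ^ 2).trace = (Fintype.card V : ℝ) ^ 2 + 3 * nonAdjSum G := by
  rw [pow_two]
  simp only [trace, diag_apply, mul_apply, distMatrix_add_one_apply hG hd]
  have : ∀ x y : V, (1 + nonAdj G x y) * (1 + nonAdj G y x) = 1 + 3 * nonAdj G x y := by
    intro x y
    rw [nonAdj_comm y x]
    linear_combination nonAdj_sq (G := G) x y
  simp only [this, nonAdjSum, Finset.sum_add_distrib, Finset.mul_sum]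
  simp [pow_two]

theorem sum_rotate (F : V → V → V → ℝ) :
    ∑ x, ∑ y, ∑ z, F y z x = ∑ x, ∑ y, ∑ z, F x y z := by
  rw [Finset.sum_comm]
  exact Finset.sum_congr rfl fun x _ => Finset.sum_comm

/-- With no triangle in the complement, both the trace and `commonNeighborSum` are affine in `Q`,
the number of two-step walks in the complement; the combination eliminates `Q`. -/
theorem two_mul_trace_cube_eq [DecidableEq V] (hG : G.Connected) (hd : ∀ x y, G.dist x y ≤ 2)
    (hi : ∀ x y z, nonAdj G x y * nonAdj G y z * nonAdj G z x = 0) :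
    2 * ((distMatrix G + 1) ^ 3).trace + 3 * commonNeighborSum G =
      2 * (Fintype.card V : ℝ) ^ 3 + 9 * Fintype.card V * nonAdjSum G := by
  have hcube : ((distMatrix G + 1) ^ 3).trace = ∑ x, ∑ y, ∑ z,
      (1 + nonAdj G x y) * (1 + nonAdj G y z) * (1 + nonAdj G z x) := by
    rw [pow_succ, pow_two]
    simp only [trace, diag_apply, mul_apply, distMatrix_add_one_apply hG hd, Finset.sum_mul]
    exact Finset.sum_congr rfl fun x _ => Finset.sum_comm
  set Q : ℝ := ∑ x, ∑ y, ∑ z, nonAdj G x y * nonAdj G y z with hQ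
  have s1 : ∑ x, ∑ y, ∑ _z : V, nonAdj G x y = Fintype.card V * nonAdjSum G := by
    simp [nonAdjSum, Finset.mul_sum]
  have s2 : ∑ _x : V, ∑ y, ∑ z, nonAdj G y z = Fintype.card V * nonAdjSum G := by
    rw [← s1, sum_rotate fun x y _ => nonAdj G x y]
  have s3 : ∑ x, ∑ _y : V, ∑ z, nonAdj G z x = Fintype.card V * nonAdjSum G := by
    rw [← s2, sum_rotate fun _ y z => nonAdj G y z]
  have q2 : ∑ x, ∑ y, ∑ z, nonAdj G y z * nonAdj G z x = Q := by
    rw [hQ, sum_rotate fun x y z => nonAdj G x y * nonAdj G y z]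
  have q3 : ∑ x, ∑ y, ∑ z, nonAdj G z x * nonAdj G x y = Q := by
    rw [← q2, sum_rotate fun x y z => nonAdj G y z * nonAdj G z x]
  have h3 : ((distMatrix G + 1) ^ 3).trace =
      (Fintype.card V : ℝ) ^ 3 + 3 * (Fintype.card V * nonAdjSum G) + 3 * Q := by
    have : ∀ x y z : V, (1 + nonAdj G x y) * (1 + nonAdj G y z) * (1 + nonAdj G z x) =
        1 + nonAdj G x y + nonAdj G y z + nonAdj G z x + nonAdj G x y * nonAdj G y z +
          nonAdj G y z * nonAdj G z x + nonAdj G z x * nonAdj G x y :=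
      fun x y z => by linear_combination hi x y z
    rw [hcube]
    simp only [this, Finset.sum_add_distrib]
    rw [s1, s2, s3, q2, q3, ← hQ]
    simp only [Finset.sum_const, Finset.card_univ, nsmul_eq_mul]
    ring
  have hT : commonNeighborSum G = Fintype.card V * nonAdjSum G - 2 * Q := by
    have : ∀ x y z : V, nonAdj G x y * ((1 - nonAdj G x z) * (1 - nonAdj G y z)) =
        nonAdj G x y - nonAdj G z x * nonAdj G x y - nonAdj G x y * nonAdj G y z := by
      intro x y z
      rw [nonAdj_comm x z]
      linear_combination hi x y z
    simp only [commonNeighborSum, Finset.mul_sum, this, Finset.sum_sub_distrib]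
    rw [s1, q3, ← hQ]
    ring
  rw [h3, hT]
  ring

end Counting

/-! ### Two cliques glued at a vertex, encoded by a 3-colouring. -/

section Coloring

variable {V : Type*} {G : SimpleGraph V} {col : V → Fin 3}

/-- `G` consists of two cliques, the vertices of colours `0, 1` and those of colours `1, 2`, where
exactly one vertex has colour `1`. -/
structure IsGluing (G : SimpleGraph V) (col : V → Fin 3) : Prop where
  adj_iff : ∀ x y, G.Adj x y ↔
    x ≠ y ∧ ¬ ((col x = 0 ∧ col y = 2) ∨ (col x = 2 ∧ col y = 0))
  center : ∃ c, ∀ x, col x = 1 ↔ x = c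

namespace IsGluing

theorem nonAdj_eq (h : IsGluing G col) (x y : V) : nonAdj G x y =
    (if col x = 0 then 1 else 0) * (if col y = 2 then 1 else 0) +
      (if col x = 2 then 1 else 0) * (if col y = 0 then 1 else 0) := by
  have key : x ≠ y ∧ ¬ G.Adj x y ↔ (col x = 0 ∧ col y = 2) ∨ (col x = 2 ∧ col y = 0) := by
    rw [h.adj_iff]
    constructor
    · tauto
    · intro h'
      refine ⟨?_, by tauto⟩
      rintro rfl
      rcases h' with h' | h' <;> simp [h'.1] at h'
  simp only [nonAdj, key]
  generalize col x = a
  generalize col y = b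
  fin_cases a <;> fin_cases b <;> simp

theorem nonAdj_triangle (h : IsGluing G col) (x y z : V) :
    nonAdj G x y * nonAdj G y z * nonAdj G z x = 0 := by
  simp only [h.nonAdj_eq]
  generalize col x = a
  generalize col y = b
  generalize col z = c
  fin_cases a <;> fin_cases b <;> fin_cases c <;> simp

theorem exists_walk (h : IsGluing G col) (x y : V) : ∃ p : G.Walk x y, p.length ≤ 2 := by
  by_cases hxy : x = y
  · subst hxy
    exact ⟨.nil, by simp⟩
  by_cases hadj : G.Adj x y
  · exact ⟨hadj.toWalk, by simp⟩
  have hcol : (col x = 0 ∧ col y = 2) ∨ (col x = 2 ∧ col y = 0) := by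
    rw [h.adj_iff] at hadj
    tauto
  obtain ⟨c, hc⟩ := h.center
  have h1 : col c = 1 := (hc c).2 rfl
  have hx : col x ≠ 1 := by rcases hcol with h' | h' <;> simp [h'.1]
  have hy : col y ≠ 1 := by rcases hcol with h' | h' <;> simp [h'.2]
  have hxc : G.Adj x c := (h.adj_iff x c).2 ⟨fun e => hx ((hc x).2 e), by simp [h1]⟩
  have hcy : G.Adj c y := (h.adj_iff c y).2 ⟨fun e => hy ((hc y).2 e.symm), by simp [h1]⟩
  exact ⟨.cons hxc (.cons hcy .nil), by simp⟩

theorem connected (h : IsGluing G col) : G.Connected := by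
  obtain ⟨c, -⟩ := h.center
  have : Nonempty V := ⟨c⟩
  exact ⟨fun x y => (h.exists_walk x y).choose.reachable⟩

theorem dist_le_two (h : IsGluing G col) (x y : V) : G.dist x y ≤ 2 := by
  obtain ⟨p, hp⟩ := h.exists_walk x y
  exact (SimpleGraph.dist_le p).trans hp

theorem swap (h : IsGluing G col) : IsGluing G (fun x => Fin.rev (col x)) := by
  have h0 : ∀ i : Fin 3, Fin.rev i = 0 ↔ i = 2 := by decide
  have h1 : ∀ i : Fin 3, Fin.rev i = 1 ↔ i = 1 := by decide
  have h2 : ∀ i : Fin 3, Fin.rev i = 2 ↔ i = 0 := by decide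
  obtain ⟨c, hc⟩ := h.center
  refine ⟨fun x y => ?_, c, fun x => by rw [h1, hc]⟩
  rw [h.adj_iff, h0, h2, h0, h2, or_comm]

variable [Fintype V]

theorem nonAdjSum_eq (h : IsGluing G col) : nonAdjSum G =
    2 * ((Finset.univ.filter fun x => col x = 0).card : ℝ) *
      ((Finset.univ.filter fun x => col x = 2).card : ℝ) := by
  simp only [nonAdjSum, h.nonAdj_eq, Finset.sum_add_distrib, ← Finset.mul_sum, ← Finset.sum_mul,
    Finset.sum_boole]
  ring

theorem commonNeighborSum_eq (h : IsGluing G col) : commonNeighborSum G = nonAdjSum G := by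
  classical
  obtain ⟨c, hc⟩ := h.center
  refine Finset.sum_congr rfl fun x _ => Finset.sum_congr rfl fun y _ => ?_
  have key : ∀ z, nonAdj G x y * ((1 - nonAdj G x z) * (1 - nonAdj G y z)) =
      nonAdj G x y * if z = c then 1 else 0 := by
    intro z
    simp only [h.nonAdj_eq, ← hc]
    generalize col x = i
    generalize col y = j
    generalize col z = k
    fin_cases i <;> fin_cases j <;> fin_cases k <;> simp
  rw [Finset.mul_sum]
  simp only [key]
  simp

theorem card_filter_center (h : IsGluing G col) :
    (Finset.univ.filter fun x => col x = 1).card = 1 := by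
  obtain ⟨c, hc⟩ := h.center
  exact Finset.card_eq_one.2 ⟨c, by ext x; simp [hc]⟩

theorem card_eq (h : IsGluing G col) : Fintype.card V =
    (Finset.univ.filter fun x => col x = 0).card + 1 +
      (Finset.univ.filter fun x => col x = 2).card := by
  rw [← Finset.card_univ, Finset.card_eq_sum_card_fiberwise (f := col) (t := Finset.univ)
    (fun _ _ => Finset.mem_coe.2 (Finset.mem_univ _)), Fin.sum_univ_three,
    h.card_filter_center]

/-- The form is `σ² + 2αγ`, where `σ`, `α`, `γ` are the coordinate sums over all vertices, colour
`0` and colour `2`. On the hyperplane `α = 0` it is a square. -/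
theorem countP_le_one [DecidableEq V] (h : IsGluing G col) :
    (distMatrix G).charpoly.roots.countP (· < -1) ≤ 1 := by
  refine countP_roots_lt_neg_one_le_one (isHermitian_distMatrix G)
    (∑ i, (if col i = 0 then (1 : ℝ) else 0) • LinearMap.proj i) fun x hx => ?_
  simp only [LinearMap.sum_apply, LinearMap.smul_apply, LinearMap.proj_apply, smul_eq_mul] at hx
  rw [toBilin'_apply]
  simp only [distMatrix_add_one_apply h.connected h.dist_le_two, h.nonAdj_eq]
  have key : ∑ i, ∑ j, x i * (1 + ((if col i = 0 then 1 else 0) * (if col j = 2 then 1 else 0) +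
      (if col i = 2 then 1 else 0) * (if col j = 0 then 1 else 0))) * x j =
      (∑ i, x i) * (∑ j, x j) + (∑ i, (if col i = 0 then 1 else 0) * x i) *
        (∑ j, (if col j = 2 then 1 else 0) * x j) +
        (∑ i, (if col i = 2 then 1 else 0) * x i) *
          (∑ j, (if col j = 0 then 1 else 0) * x j) := by
    simp only [Finset.sum_mul_sum, ← Finset.sum_add_distrib]
    exact Finset.sum_congr rfl fun i _ => Finset.sum_congr rfl fun j _ => by ring
  rw [key, hx, zero_mul, mul_zero, add_zero, add_zero]
  exact mul_self_nonneg _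

/-- Adjacency of distinct vertices depends only on colours, so any colour-preserving bijection is an
isomorphism. -/
theorem nonempty_iso {W : Type*} [Fintype W] {H : SimpleGraph W} {col' : W → Fin 3}
    (h : IsGluing G col) (h' : IsGluing H col')
    (h0 : (Finset.univ.filter fun x => col x = 0).card =
      (Finset.univ.filter fun x => col' x = 0).card)
    (h2 : (Finset.univ.filter fun x => col x = 2).card =
      (Finset.univ.filter fun x => col' x = 2).card) : Nonempty (G ≃g H) := by
  have hcard : ∀ i, Fintype.card {x // col x = i} = Fintype.card {x // col' x = i} := by
    intro i
    rw [Fintype.card_subtype, Fintype.card_subtype]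
    fin_cases i
    · exact h0
    · exact h.card_filter_center.trans h'.card_filter_center.symm
    · exact h2
  let e : V ≃ W := (Equiv.sigmaFiberEquiv col).symm.trans
    ((Equiv.sigmaCongrRight fun i => Fintype.equivOfCardEq (hcard i)).trans
      (Equiv.sigmaFiberEquiv col'))
  have he : ∀ x, col' (e x) = col x := fun x =>
    (Fintype.equivOfCardEq (hcard (col x)) ⟨x, rfl⟩).2
  refine ⟨⟨e, fun {x y} => ?_⟩⟩
  rw [h.adj_iff, h'.adj_iff, he, he, e.injective.ne_iff]

end IsGluing

/-- The colouring of the vertices of `gluedCliques s t`. -/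
def gluedCliquesColoring (s t : ℕ) (i : Fin (s + t - 1)) : Fin 3 :=
  if i.val + 1 < s then 0 else if i.val + 1 = s then 1 else 2

theorem gluedCliquesColoring_eq_zero {s t : ℕ} (i : Fin (s + t - 1)) :
    gluedCliquesColoring s t i = 0 ↔ i.val < s - 1 := by
  unfold gluedCliquesColoring
  split_ifs <;> simp <;> omega

theorem gluedCliquesColoring_eq_one {s t : ℕ} (i : Fin (s + t - 1)) :
    gluedCliquesColoring s t i = 1 ↔ i.val + 1 = s := by
  unfold gluedCliquesColoring
  split_ifs <;> simp <;> omega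

theorem gluedCliquesColoring_eq_two {s t : ℕ} (i : Fin (s + t - 1)) :
    gluedCliquesColoring s t i = 2 ↔ s < i.val + 1 := by
  unfold gluedCliquesColoring
  split_ifs <;> simp <;> omega

theorem isGluing_gluedCliques {s t : ℕ} (hs : 1 ≤ s) (ht : 1 ≤ t) :
    IsGluing (gluedCliques s t) (gluedCliquesColoring s t) := by
  refine ⟨fun x y => ?_, ⟨s - 1, by omega⟩, fun x => ?_⟩
  · simp only [gluedCliquesColoring_eq_zero, gluedCliquesColoring_eq_two, gluedCliques]
    refine and_congr_right fun _ => ?_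
    omega
  · rw [gluedCliquesColoring_eq_one, Fin.ext_iff]
    simp only
    omega

theorem card_gluedCliquesColoring_zero {s t : ℕ} (ht : 1 ≤ t) :
    (Finset.univ.filter fun i => gluedCliquesColoring s t i = 0).card = s - 1 := by
  simp only [gluedCliquesColoring_eq_zero, Fin.card_filter_val_lt]
  omega

end Coloring

/-! ### Recovering the two cliques from the spectrum. -/

section Structure

variable {V : Type*} {G : SimpleGraph V}

theorem nonAdj_nonneg (x y : V) : 0 ≤ nonAdj G x y := by
  rcases nonAdj_eq_zero_or_one (G := G) x y with h | h <;> simp [h]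

theorem nonAdj_le_one (x y : V) : nonAdj G x y ≤ 1 := by
  rcases nonAdj_eq_zero_or_one (G := G) x y with h | h <;> simp [h]

theorem nonAdj_triangle_eq_zero (hi : ∀ a b c : V, a ≠ b → a ≠ c → b ≠ c → ¬ G.Adj a b →
    ¬ G.Adj a c → G.Adj b c) (x y z : V) : nonAdj G x y * nonAdj G y z * nonAdj G z x = 0 := by
  by_cases hxy : x ≠ y ∧ ¬ G.Adj x y
  · by_cases hyz : y ≠ z ∧ ¬ G.Adj y z
    · by_cases hzx : z = x
      · rw [hzx, nonAdj_self, mul_zero]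
      · rw [nonAdj_of_adj (hi y z x hyz.1 hxy.1.symm hzx hyz.2 fun h => hxy.2 h.symm), mul_zero]
    · simp [nonAdj, hyz]
  · simp [nonAdj, hxy]

/-- In a graph of diameter at most two in which the number of common neighbours averages to one
over the nonadjacent pairs, every nonadjacent pair has exactly one common neighbour. -/
theorem existsUnique_common_neighbor [Fintype V] (hG : G.Connected) (hd : ∀ x y, G.dist x y ≤ 2)
    (hT : commonNeighborSum G = nonAdjSum G) {x y : V} (hxy : x ≠ y) (hadj : ¬ G.Adj x y) :
    ∃ c, G.Adj x c ∧ G.Adj y c ∧ ∀ z, G.Adj x z → G.Adj y z → z = c := by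
  classical
  have hex : ∀ {x y : V}, x ≠ y → ¬ G.Adj x y → ∃ c, G.Adj x c ∧ G.Adj y c := by
    intro x y hxy hadj
    obtain ⟨c, hxc, hcy⟩ := exists_adj_dist_eq hG (dist_eq_two hG hd hxy hadj)
    exact ⟨c, hxc, (SimpleGraph.dist_eq_one_iff_adj.1 hcy).symm⟩
  have hterm : ∀ x y z : V, 0 ≤ (1 - nonAdj G x z) * (1 - nonAdj G y z) := fun x y z =>
    mul_nonneg (sub_nonneg.2 (nonAdj_le_one x z)) (sub_nonneg.2 (nonAdj_le_one y z))
  have hone : ∀ {x y z : V}, G.Adj x z → G.Adj y z →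
      (1 - nonAdj G x z) * (1 - nonAdj G y z) = 1 := by
    intro x y z hx hy
    simp [nonAdj_of_adj hx, nonAdj_of_adj hy]
  have hle : ∀ x y : V, nonAdj G x y ≤
      nonAdj G x y * ∑ z, (1 - nonAdj G x z) * (1 - nonAdj G y z) := by
    intro x y
    by_cases h : x ≠ y ∧ ¬ G.Adj x y
    · obtain ⟨c, hx, hy⟩ := hex h.1 h.2
      refine le_mul_of_one_le_right (nonAdj_nonneg x y) ?_
      exact (hone hx hy).symm.le.trans (Finset.single_le_sum
        (f := fun z => (1 - nonAdj G x z) * (1 - nonAdj G y z))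
        (fun z _ => hterm x y z) (Finset.mem_univ c))
    · simp [nonAdj, h]
  -- Equal totals and termwise inequality force termwise equality.
  have heq : nonAdj G x y = nonAdj G x y * ∑ z, (1 - nonAdj G x z) * (1 - nonAdj G y z) := by
    have h1 := (Finset.sum_eq_sum_iff_of_le fun x _ =>
      Finset.sum_le_sum fun y _ => hle x y).1 hT.symm x (Finset.mem_univ x)
    exact (Finset.sum_eq_sum_iff_of_le fun y _ => hle x y).1 h1 y (Finset.mem_univ y)
  rw [nonAdj_of_not_adj hxy hadj, one_mul] at heq
  obtain ⟨c, hx, hy⟩ := hex hxy hadj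
  refine ⟨c, hx, hy, fun z hxz hyz => ?_⟩
  by_contra hzc
  have h2 := Finset.sum_le_sum_of_subset_of_nonneg
    (f := fun z => (1 - nonAdj G x z) * (1 - nonAdj G y z)) (Finset.subset_univ {z, c})
    fun w _ _ => hterm x y w
  rw [Finset.sum_pair hzc, hone hxz hyz, hone hx hy, ← heq] at h2
  norm_num at h2

/-- The structure of the graphs with independence number at most two and no induced pentagon in
which all nonadjacent pairs have exactly one common neighbour. -/
theorem exists_isGluing
    (hi : ∀ a b c : V, a ≠ b → a ≠ c → b ≠ c → ¬ G.Adj a b → ¬ G.Adj a c → G.Adj b c)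
    (hp : ∀ c u x y v : V, G.Adj c u → G.Adj u x → G.Adj x y → G.Adj y v → G.Adj v c →
      ¬ G.Adj c x → ¬ G.Adj c y → ¬ G.Adj u y → ¬ G.Adj u v → ¬ G.Adj x v → False)
    (hu : ∀ x y : V, x ≠ y → ¬ G.Adj x y →
      ∃ c, G.Adj x c ∧ G.Adj y c ∧ ∀ z, G.Adj x z → G.Adj y z → z = c)
    {u v : V} (huv : u ≠ v) (hnuv : ¬ G.Adj u v) : ∃ col, IsGluing G col := by
  classical
  obtain ⟨c, huc, hvc, hc⟩ := hu u v huv hnuv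
  -- `A` will consist of non-neighbours of `v`, `B` of non-neighbours of `u`; independence number
  -- two makes both cliques.
  let A : V → Prop := fun x => x ≠ c ∧ (x = u ∨ G.Adj u x)
  let B : V → Prop := fun x => x ≠ c ∧ x ≠ u ∧ ¬ G.Adj u x
  have hAv : ∀ {x}, A x → x ≠ v ∧ ¬ G.Adj v x := by
    rintro x ⟨hxc, rfl | hx⟩
    · exact ⟨huv, fun h => hnuv h.symm⟩
    · exact ⟨by rintro rfl; exact hnuv hx, fun h => hxc (hc x hx h)⟩
  have hBv : ∀ {x}, B x → x = v ∨ G.Adj v x := by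
    rintro x ⟨-, hxu, hx⟩
    by_cases hxv : x = v
    · exact Or.inl hxv
    · exact Or.inr (hi u v x huv hxu.symm (Ne.symm hxv) hnuv hx)
  have hAA : ∀ {x y}, A x → A y → x ≠ y → G.Adj x y := fun hx hy hxy =>
    hi v _ _ (hAv hx).1.symm (hAv hy).1.symm hxy (hAv hx).2 (hAv hy).2
  have hBB : ∀ {x y}, B x → B y → x ≠ y → G.Adj x y := fun hx hy hxy =>
    hi u _ _ hx.2.1.symm hy.2.1.symm hxy hx.2.2 hy.2.2
  -- An edge `x y` with `x ≠ u`, `y ≠ v` closes the pentagon `c u x y v`. A chord `c y` would give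
  -- `u, y` two common neighbours, `x` and `c`; likewise `c x` for `v, x`.
  have hAB : ∀ {x y}, A x → B y → ¬ G.Adj x y := by
    intro x y hx hy hxy
    rcases hx.2 with rfl | hux
    · exact hy.2.2 hxy
    rcases hBv hy with rfl | hvy
    · exact (hAv hx).2 hxy.symm
    have hcy : ¬ G.Adj c y := by
      intro h
      obtain ⟨w, -, -, hw⟩ := hu u y hy.2.1.symm hy.2.2
      exact hx.1 ((hw x hux hxy.symm).trans (hw c huc h.symm).symm)
    have hcx : ¬ G.Adj c x := by
      intro h
      obtain ⟨w, -, -, hw⟩ := hu v x (hAv hx).1.symm (hAv hx).2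
      exact hy.1 ((hw y hvy hxy).trans (hw c hvc h.symm).symm)
    exact hp c u x y v huc.symm hux hxy hvy.symm hvc hcx hcy hy.2.2 hnuv
      fun h => (hAv hx).2 h.symm
  have hor : ∀ x, x ≠ c → A x ∨ B x := by
    intro x hx
    by_cases h : x = u ∨ G.Adj u x
    · exact Or.inl ⟨hx, h⟩
    · exact Or.inr ⟨hx, by tauto⟩
  -- A common neighbour of `x` and the end `u` or `v` on the other side lies in neither `A` nor `B`,
  -- so it is `c`.
  have hcadj : ∀ x, x ≠ c → G.Adj c x := by
    intro x hx
    rcases hor x hx with hA | hB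
    · obtain ⟨w, hvw, hxw, -⟩ := hu v x (hAv hA).1.symm (hAv hA).2
      by_cases hwc : w = c
      · exact hwc ▸ hxw.symm
      · rcases hor w hwc with h | h
        · exact absurd hvw (hAv h).2
        · exact absurd hxw (hAB hA h)
    · obtain ⟨w, huw, hxw, -⟩ := hu u x hB.2.1.symm hB.2.2
      by_cases hwc : w = c
      · exact hwc ▸ hxw.symm
      · rcases hor w hwc with h | h
        · exact absurd hxw.symm (hAB h hB)
        · exact absurd huw h.2.2
  have hnAB : ∀ x, A x → ¬ B x := fun x hx hy => by
    rcases hx.2 with h | h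
    · exact hy.2.1 h
    · exact hy.2.2 h
  let col : V → Fin 3 := fun x => if x = c then 1 else if A x then 0 else 2
  have col0 : ∀ x, col x = 0 ↔ A x := by
    intro x
    by_cases h : x = c
    · simp [col, A, h]
    · by_cases hA : A x <;> simp [col, h, hA]
  have col1 : ∀ x, col x = 1 ↔ x = c := by
    intro x
    by_cases h : x = c
    · simp [col, h]
    · by_cases hA : A x <;> simp [col, h, hA]
  have col2 : ∀ x, col x = 2 ↔ B x := by
    intro x
    by_cases h : x = c
    · simp [col, B, h]
    · by_cases hA : A x
      · simp [col, h, hA, hnAB x hA]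
      · simp [col, h, hA, (hor x h).resolve_left hA]
  refine ⟨col, fun x y => ?_, c, col1⟩
  rw [col0, col0, col2, col2]
  refine ⟨fun h => ⟨h.ne, ?_⟩, ?_⟩
  · rintro (⟨hx, hy⟩ | ⟨hx, hy⟩)
    · exact hAB hx hy h
    · exact hAB hy hx h.symm
  · rintro ⟨hxy, hn⟩
    by_cases hxc : x = c
    · exact hxc ▸ hcadj y fun h => hxy (hxc.trans h.symm)
    by_cases hyc : y = c
    · exact hyc ▸ (hcadj x hxc).symm
    rcases hor x hxc with hx | hx <;> rcases hor y hyc with hy | hy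
    · exact hAA hx hy hxy
    · exact absurd (Or.inl ⟨hx, hy⟩) hn
    · exact absurd (Or.inr ⟨hx, hy⟩) hn
    · exact hBB hx hy hxy

/-- The number of vertices is determined by the distance spectrum. -/
theorem card_roots_distMatrix [Fintype V] [DecidableEq V] :
    Multiset.card (distMatrix G).charpoly.roots = Fintype.card V := by
  rw [(isHermitian_distMatrix G).roots_charpoly_eq_eigenvalues]
  simp

/-- A connected graph cospectral to a gluing of two cliques is a gluing of two cliques, with the
same number of vertices and of nonadjacent pairs. -/
theorem IsGluing.of_distSpectrum_eq {W : Type*} [Fintype V] [DecidableEq V] [Fintype W]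
    [DecidableEq W] {H : SimpleGraph W} {col : V → Fin 3} (h : IsGluing G col)
    (hpos : nonAdjSum G ≠ 0) (hH : H.Connected) (hs : distSpectrum H = distSpectrum G) :
    Fintype.card W = Fintype.card V ∧ nonAdjSum H = nonAdjSum G ∧ ∃ col', IsGluing H col' := by
  have hcard : Fintype.card W = Fintype.card V := by
    rw [← card_roots_distMatrix (G := H), ← card_roots_distMatrix (G := G)]
    exact congrArg _ hs
  have hc : (distMatrix H).charpoly.roots.countP (· < -1) ≤ 1 := by
    have := h.countP_le_one
    rwa [← distSpectrum, ← hs] at this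
  have htr : ∀ k, ((distMatrix H + 1) ^ k).trace = ((distMatrix G + 1) ^ k).trace := by
    intro k
    rw [trace_add_one_pow (isHermitian_distMatrix H), trace_add_one_pow (isHermitian_distMatrix G),
      ← distSpectrum, hs, distSpectrum]
  have hd := dist_le_two_of_countP_le_one hH hc
  have hi : ∀ a b c : W, a ≠ b → a ≠ c → b ≠ c → ¬ H.Adj a b → ¬ H.Adj a c → H.Adj b c :=
    fun a b c => adj_of_countP_le_one hH hc
  have hS : nonAdjSum H = nonAdjSum G := by
    have := htr 2
    rw [trace_sq_eq hH hd, trace_sq_eq h.connected h.dist_le_two, hcard] at this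
    linarith
  -- All other terms of the cubic identity agree for both graphs, and in `G` the two sums coincide.
  have hT : commonNeighborSum H = nonAdjSum H := by
    have h1 := two_mul_trace_cube_eq hH hd (nonAdj_triangle_eq_zero hi)
    have h2 := two_mul_trace_cube_eq h.connected h.dist_le_two h.nonAdj_triangle
    rw [htr 3, hcard, hS] at h1
    rw [hS, ← h.commonNeighborSum_eq]
    linarith
  refine ⟨hcard, hS, ?_⟩
  obtain ⟨u, v, huv, hadj⟩ : ∃ u v : W, u ≠ v ∧ ¬ H.Adj u v := by
    by_contra! hall
    refine hpos (hS ▸ Finset.sum_eq_zero fun x _ => Finset.sum_eq_zero fun y _ => ?_)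
    by_cases hxy : x = y
    · rw [hxy, nonAdj_self]
    · exact nonAdj_of_adj (hall x y hxy)
  exact exists_isGluing hi
    (fun c u x y v => no_induced_pentagon_of_countP_le_one hH hc)
    (fun x y => existsUnique_common_neighbor hH hd hT) huv hadj

end Structure

end DSpectrum

/-! ### The main theorem: matching the clique sizes. -/

theorem theorem3p5 (s t : ℕ) (hs : 2 ≤ s) (ht : 2 ≤ t) :
    DSpectrum.DeterminedByDSpectrum.{0, v} (DSpectrum.gluedCliques s t) := by
  have hK := DSpectrum.isGluing_gluedCliques (s := s) (t := t) (by omega) (by omega)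
  refine ⟨hK.connected, fun W _ _ H hH hcosp => ?_⟩
  have hK0 := DSpectrum.card_gluedCliquesColoring_zero (s := s) (t := t) (by omega)
  have hKc := hK.card_eq
  rw [Fintype.card_fin] at hKc
  have hKS := hK.nonAdjSum_eq
  set a := (Finset.univ.filter fun x => DSpectrum.gluedCliquesColoring s t x = 0).card
  set b := (Finset.univ.filter fun x => DSpectrum.gluedCliquesColoring s t x = 2).card
  have ha : a ≠ 0 := by omega
  have hb : b ≠ 0 := by omega
  obtain ⟨hcard, hS, col, hcol⟩ := hK.of_distSpectrum_eq
    (by rw [hKS]; positivity) hH hcosp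
  have hHc := hcol.card_eq
  rw [hcard, Fintype.card_fin, hKc] at hHc
  have hprod := hcol.nonAdjSum_eq
  rw [hS, hKS, mul_assoc, mul_assoc, mul_right_inj' two_ne_zero] at hprod
  have hprod' : a * b = (Finset.univ.filter fun x => col x = 0).card *
      (Finset.univ.filter fun x => col x = 2).card := by exact_mod_cast hprod
  set p := (Finset.univ.filter fun x => col x = 0).card with hp
  set q := (Finset.univ.filter fun x => col x = 2).card with hq
  have hsum : a + b = p + q := by omega
  have hor : p = a ∨ p = b := by
    -- Equal sum and product make `p` a root of `(X - a)(X - b)`.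
    have : ((p : ℤ) - a) * (p - b) = 0 := by
      zify at hsum hprod'
      linear_combination (-(p : ℤ)) * hsum + hprod'
    rcases mul_eq_zero.1 this with h | h
    · left; omega
    · right; omega
  rcases hor with h | h
  · exact hcol.nonempty_iso hK h (by omega)
  -- The cliques come in the opposite order, so colours `0` and `2` are exchanged.
  · have h0 : ∀ i : Fin 3, Fin.rev i = 0 ↔ i = 2 := by decide
    have h2 : ∀ i : Fin 3, Fin.rev i = 2 ↔ i = 0 := by decide
    refine hcol.swap.nonempty_iso hK ?_ ?_
    · simp only [h0, ← hq]
      omega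
    · simp only [h2, ← hp]
      omega
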